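/- Let $(\mathcal{D},\mathbb{E},\mathfrak{s})$ be an extriangulated category in the sense of Nakaoka–Palu: $\mathcal{D}$ is an additive category, $\mathbb{E}:\mathcal{D}^{op}\times\mathcal{D}\to\mathrm{Ab}$ an additive bifunctor, and $\mathfrak{s}$ an additive realization assigning to each $\delta\in\mathbb{E}(C,A)$ an equivalence class of sequences $A\to B\to C$, subject to the axioms (ET1)–(ET4), (ET3)$^{op}$, (ET4)$^{op}$. If $A\to B\to C$ belongs to $\mathfrak{s}(\delta)$, it is called a conflation realizing $\delta$. Assume that $\mathcal{D}$ has a negative first extension: there are an additive bifunctor $\mathbb{E}^{-1}:\mathcal{D}^{op}\times\mathcal{D}\to\mathrm{Ab}$ and, for each $\delta\in\mathbb{E}(C,A)$, natural transformations $\delta^{-1}:\mathbb{E}^{-1}(-,C)\to\mathcal{D}(-,A)$ and $\delta_{-1}:\mathbb{E}^{-1}(A,-)\to\mathcal{D}(C,-)$ such that, for every conflation $A\xrightarrow{u}B\xrightarrow{v}C$ realizing $\delta$ and every $W\in\mathcal{D}$, the sequences $$\mathbb{E}^{-1}(W,A)\to\mathbb{E}^{-1}(W,B)\to\mathbb{E}^{-1}(W,C)\xrightarrow{\delta^{-1}}\mathcal{D}(W,A)\to\mathcal{D}(W,B),$$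 $$\mathbb{E}^{-1}(C,W)\to\mathbb{E}^{-1}(B,W)\to\mathbb{E}^{-1}(A,W)\xrightarrow{\delta_{-1}}\mathcal{D}(C,W)\to\mathcal{D}(B,W)$$ are exact. For $V\in\mathcal{D}$, let $\mathrm{Gen}(V)$ be the class of all objects $X$ such that $X=0$ or there is a conflation $A\to\coprod_\alpha V\xrightarrow{f}X$ with $f\neq0$ for some set $\alpha$ for which the coproduct $\coprod_\alpha V$ of copies of $V$ exists in $\mathcal{D}$. Let $\mathrm{Pres}(V)$ be the class of all $X$ such that $X=0$ or there is such a conflation with, in addition, $A\in\mathrm{Gen}(V)$. Put $V^{\perp_0}=\{X:\mathcal{D}(V,X)=0\}$ and $V^{\perp_1}=\{X:\mathbb{E}(V,X)=0\}$. The object $V$ is called an extended tilting object if 1. $(\mathcal{T},\mathcal{F})=(\mathrm{Gen}(V),V^{\perp_0})$ is an $s$-torsion pair, i.e. both classes are closed under isomorphisms, $\mathcal{D}(\mathcal{T},\mathcal{F})=0$, $\mathbb{E}^{-1}(\mathcal{T},\mathcal{F})=0$, and every $M\in\mathcal{D}$ admits a conflation $T\to M\to F$ with $T\in\mathcal{T}$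 and $F\in\mathcal{F}$; 2. $\mathrm{Gen}(V)=\mathrm{Pres}(V)$ and $\mathrm{Gen}(V)=V^{\perp_1}$; 3. every $X\in\mathcal{D}$ admits a conflation $X\to T\to Y$ with $T\in\mathrm{Gen}(V)$. **Proposition.** Every extended tilting object $V$ of $\mathcal{D}$ is $\mathbb{E}$-universal: for each $D\in\mathcal{D}$ there are a non-empty set $\alpha$ for which the coproduct $\coprod_\alpha V$ exists in $\mathcal{D}$ and a conflation $D\to A\to\coprod_\alpha V$ realizing some $\delta\in\mathbb{E}(\coprod_\alpha V,D)$ such that the connecting map $$\mathrm{Hom}_{\mathcal{D}}(V,\textstyle\coprod_\alpha V)\to\mathbb{E}(V,D),\qquad\varphi\mapsto\mathbb{E}(\varphi,D)(\delta),$$ is surjective. -/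

import Mathlib

open CategoryTheory CategoryTheory.Limits Opposite

universe w₁ w₂ w v u

namespace ExtendedTilting

section Bifunctor

variable {D : Type u} [Category.{v} D] [Preadditive D]

/-- A bifunctor `Dᵒᵖ × D ⥤ Ab` (in curried form) is additive if it is additive in each variable. -/
structure IsAdditiveBifunctor (F : Dᵒᵖ ⥤ D ⥤ AddCommGrpCat.{w}) : Prop where
  left : F.Additive
  right : ∀ C : Dᵒᵖ, (F.obj C).Additive

/-- The underlying type of the abelian group `F(C, A)`. -/
abbrev Val (F : Dᵒᵖ ⥤ D ⥤ AddCommGrpCat.{w}) (C A : D) : Type w := (F.obj (op C)).obj A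

/-- The map `F(C, a) : F(C, A) → F(C, A')` induced by `a : A ⟶ A'`. -/
def push (F : Dᵒᵖ ⥤ D ⥤ AddCommGrpCat.{w}) {A A' : D} (C : D) (a : A ⟶ A') :
    Val F C A →+ Val F C A' :=
  ((F.obj (op C)).map a).hom

/-- The map `F(c, A) : F(C, A) → F(C', A)` induced by `c : C' ⟶ C`. -/
def pull (F : Dᵒᵖ ⥤ D ⥤ AddCommGrpCat.{w}) {C' C : D} (c : C' ⟶ C) (A : D) :
    Val F C A →+ Val F C' A :=
  ((F.map c.op).app A).hom

end Bifunctor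

section Sequences

variable {D : Type u} [Category.{v} D]

/-- A sequence of two morphisms `A ⟶ mid ⟶ C` with fixed end terms. -/
structure Seq (A C : D) where
  mid : D
  x : A ⟶ mid
  y : mid ⟶ C

/-- Two sequences `A ⟶ B ⟶ C` and `A ⟶ B' ⟶ C` are equivalent if there is an isomorphism
`B ≅ B'` compatible with the identities of `A` and of `C`. -/
instance seqSetoid (A C : D) : Setoid (Seq A C) where
  r S T := ∃ b : S.mid ≅ T.mid, S.x ≫ b.hom = T.x ∧ b.hom ≫ T.y = S.y
  iseqv :=
    { refl := fun S => ⟨Iso.refl _, by simp, by simp⟩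
      symm := by
        rintro S T ⟨b, h₁, h₂⟩
        exact ⟨b.symm, by simp [← h₁], by simp [← h₂]⟩
      trans := by
        rintro S T U ⟨b, h₁, h₂⟩ ⟨c, h₃, h₄⟩
        exact ⟨b ≪≫ c, by simp [← h₃, ← h₁], by simp [h₄, h₂]⟩ }

/-- Equivalence classes of sequences `A ⟶ B ⟶ C`. -/
def SeqClass (A C : D) := Quotient (seqSetoid A C)

/-- The equivalence class `[A ⟶ B ⟶ C]`. -/
def SeqClass.mk {A B C : D} (x : A ⟶ B) (y : B ⟶ C) : SeqClass A C :=
  Quotient.mk (seqSetoid A C) ⟨B, x, y⟩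

end Sequences

/-- An extriangulated structure `(𝔼, 𝔰)` on the additive category `D`, in the sense of
Nakaoka and Palu. -/
structure Extriangulated (D : Type u) [Category.{v} D] [Preadditive D]
    [HasZeroObject D] [HasBinaryBiproducts D] where
  /-- The bifunctor `𝔼`. -/
  E : Dᵒᵖ ⥤ D ⥤ AddCommGrpCat.{w₁}
  /-- (ET1) -/
  additive : IsAdditiveBifunctor E
  /-- The correspondence `𝔰`. -/
  s : ∀ {C A : D}, Val E C A → SeqClass A C
  /-- (ET2) `𝔰` is a realization: morphisms of extensions lift to the middle terms. -/
  realization : ∀ {A B C A' B' C' : D} {x : A ⟶ B} {y : B ⟶ C} {x' : A' ⟶ B'} {y' : B' ⟶ C'}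
    {δ : Val E C A} {δ' : Val E C' A'}, s δ = SeqClass.mk x y → s δ' = SeqClass.mk x' y' →
    ∀ (a : A ⟶ A') (c : C ⟶ C'), push E C a δ = pull E c A' δ' →
    ∃ b : B ⟶ B', x ≫ b = a ≫ x' ∧ y ≫ c = b ≫ y'
  /-- (ET2) The split extension is realized by the split sequence. -/
  s_zero : ∀ A C : D,
    s (0 : Val E C A) = SeqClass.mk (biprod.inl : A ⟶ A ⊞ C) (biprod.snd : A ⊞ C ⟶ C)
  /-- (ET2) `𝔰` is compatible with direct sums. -/
  s_biprod : ∀ {A B C A' B' C' : D} {x : A ⟶ B} {y : B ⟶ C} {x' : A' ⟶ B'} {y' : B' ⟶ C'}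
    {δ : Val E C A} {δ' : Val E C' A'}, s δ = SeqClass.mk x y → s δ' = SeqClass.mk x' y' →
    s (push E (C ⊞ C') (biprod.inl : A ⟶ A ⊞ A') (pull E (biprod.fst : C ⊞ C' ⟶ C) A δ) +
        push E (C ⊞ C') (biprod.inr : A' ⟶ A ⊞ A') (pull E (biprod.snd : C ⊞ C' ⟶ C') A' δ')) =
      SeqClass.mk (biprod.map x x') (biprod.map y y')
  /-- (ET3) -/
  ET3 : ∀ {A B C A' B' C' : D} {x : A ⟶ B} {y : B ⟶ C} {x' : A' ⟶ B'} {y' : B' ⟶ C'}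
    {δ : Val E C A} {δ' : Val E C' A'}, s δ = SeqClass.mk x y → s δ' = SeqClass.mk x' y' →
    ∀ (a : A ⟶ A') (b : B ⟶ B'), x ≫ b = a ≫ x' →
    ∃ c : C ⟶ C', y ≫ c = b ≫ y' ∧ push E C a δ = pull E c A' δ'
  /-- (ET3)ᵒᵖ -/
  ET3op : ∀ {A B C A' B' C' : D} {x : A ⟶ B} {y : B ⟶ C} {x' : A' ⟶ B'} {y' : B' ⟶ C'}
    {δ : Val E C A} {δ' : Val E C' A'}, s δ = SeqClass.mk x y → s δ' = SeqClass.mk x' y' →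
    ∀ (b : B ⟶ B') (c : C ⟶ C'), y ≫ c = b ≫ y' →
    ∃ a : A ⟶ A', x ≫ b = a ≫ x' ∧ push E C a δ = pull E c A' δ'
  /-- (ET4): from `A ⟶ B ⟶ X` realizing `δ` and `B ⟶ C ⟶ F` realizing `δ'` one gets
  `A ⟶ C ⟶ Y` realizing some `δ''` and `X ⟶ Y ⟶ F` realizing `f'_* δ'`. -/
  ET4 : ∀ {A B C X F : D} {f : A ⟶ B} {f' : B ⟶ X} {g : B ⟶ C} {g' : C ⟶ F}
    {δ : Val E X A} {δ' : Val E F B}, s δ = SeqClass.mk f f' → s δ' = SeqClass.mk g g' →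
    ∃ (Y : D) (h' : C ⟶ Y) (d : X ⟶ Y) (e : Y ⟶ F) (δ'' : Val E Y A),
      s δ'' = SeqClass.mk (f ≫ g) h' ∧
      f' ≫ d = g ≫ h' ∧ h' ≫ e = g' ∧
      s (push E F f' δ') = SeqClass.mk d e ∧
      pull E d A δ'' = δ ∧
      push E Y f δ'' = pull E e B δ'
  /-- (ET4)ᵒᵖ: from `X ⟶ A ⟶ B` realizing `δ` and `F ⟶ B ⟶ C` realizing `δ'` one gets
  `Y ⟶ A ⟶ C` realizing some `δ''` and `X ⟶ Y ⟶ F` realizing `g'^* δ`. -/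
  ET4op : ∀ {A B C X F : D} {f' : X ⟶ A} {f : A ⟶ B} {g' : F ⟶ B} {g : B ⟶ C}
    {δ : Val E B X} {δ' : Val E C F}, s δ = SeqClass.mk f' f → s δ' = SeqClass.mk g' g →
    ∃ (Y : D) (h' : Y ⟶ A) (d : X ⟶ Y) (e : Y ⟶ F) (δ'' : Val E C Y),
      s δ'' = SeqClass.mk h' (f ≫ g) ∧
      e ≫ g' = h' ≫ f ∧ d ≫ h' = f' ∧
      s (pull E g' X δ) = SeqClass.mk d e ∧
      push E C e δ'' = δ' ∧
      push E B d δ = pull E g Y δ''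

section Notions

variable {D : Type u} [Category.{v} D] [Preadditive D] [HasZeroObject D]
  [HasBinaryBiproducts D]

/-- `A ⟶ B ⟶ C` is an `𝔰`-conflation realizing the extension `δ`, that is,
`A ⟶ B ⟶ C` together with `δ` is an `𝔼`-triangle. -/
def Extriangulated.Realizes (𝒟 : Extriangulated.{w₁} D) {A B C : D} (x : A ⟶ B) (y : B ⟶ C)
    (δ : Val 𝒟.E C A) : Prop :=
  𝒟.s δ = SeqClass.mk x y

/-- `A ⟶ B ⟶ C` is an `𝔰`-conflation. -/
def Extriangulated.IsConflation (𝒟 : Extriangulated.{w₁} D) {A B C : D} (x : A ⟶ B)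
    (y : B ⟶ C) : Prop :=
  ∃ δ : Val 𝒟.E C A, 𝒟.Realizes x y δ

/-- A negative first extension on an extriangulated category: an additive bifunctor `𝔼⁻¹` and,
for every `δ ∈ 𝔼(C, A)`, natural transformations `δ⁻¹ : 𝔼⁻¹(-, C) ⟶ D(-, A)` and
`δ₋₁ : 𝔼⁻¹(A, -) ⟶ D(C, -)` of functors to abelian groups, which continue the long exact sequences
of every `𝔰`-conflation to the left. -/
structure NegativeFirstExtension (𝒟 : Extriangulated.{w₁} D) where
  /-- The bifunctor `𝔼⁻¹`. -/
  E : Dᵒᵖ ⥤ D ⥤ AddCommGrpCat.{w₂}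
  additive : IsAdditiveBifunctor E
  /-- The transformation `δ⁻¹`. -/
  conn : ∀ {C A : D} (_ : Val 𝒟.E C A) (W : D), Val E W C →+ (W ⟶ A)
  conn_natural : ∀ {C A : D} (δ : Val 𝒟.E C A) {W' W : D} (k : W' ⟶ W) (ε : Val E W C),
    conn δ W' (pull E k C ε) = k ≫ conn δ W ε
  /-- The transformation `δ₋₁`. -/
  coconn : ∀ {C A : D} (_ : Val 𝒟.E C A) (W : D), Val E A W →+ (C ⟶ W)
  coconn_natural : ∀ {C A : D} (δ : Val 𝒟.E C A) {W W' : D} (k : W ⟶ W') (ε : Val E A W),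
    coconn δ W' (push E A k ε) = coconn δ W ε ≫ k
  exact₁ : ∀ {A B C : D} {x : A ⟶ B} {y : B ⟶ C} {δ : Val 𝒟.E C A}, 𝒟.Realizes x y δ →
    ∀ W : D, Function.Exact (push E W x) (push E W y)
  exact₂ : ∀ {A B C : D} {x : A ⟶ B} {y : B ⟶ C} {δ : Val 𝒟.E C A}, 𝒟.Realizes x y δ →
    ∀ W : D, Function.Exact (push E W y) (conn δ W)
  exact₃ : ∀ {A B C : D} {x : A ⟶ B} {y : B ⟶ C} {δ : Val 𝒟.E C A}, 𝒟.Realizes x y δ →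
    ∀ W : D, Function.Exact (conn δ W) (fun a : W ⟶ A => a ≫ x)
  coexact₁ : ∀ {A B C : D} {x : A ⟶ B} {y : B ⟶ C} {δ : Val 𝒟.E C A}, 𝒟.Realizes x y δ →
    ∀ W : D, Function.Exact (pull E y W) (pull E x W)
  coexact₂ : ∀ {A B C : D} {x : A ⟶ B} {y : B ⟶ C} {δ : Val 𝒟.E C A}, 𝒟.Realizes x y δ →
    ∀ W : D, Function.Exact (pull E x W) (coconn δ W)
  coexact₃ : ∀ {A B C : D} {x : A ⟶ B} {y : B ⟶ C} {δ : Val 𝒟.E C A}, 𝒟.Realizes x y δ →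
    ∀ W : D, Function.Exact (coconn δ W) (fun c : C ⟶ W => y ≫ c)

variable (𝒟 : Extriangulated.{w₁} D)

/-- An `s`-torsion pair `(𝒯, ℱ)`: two full subcategories closed under isomorphisms with
`D(𝒯, ℱ) = 0`, `D = 𝒯 ⋆ ℱ` and `𝔼⁻¹(𝒯, ℱ) = 0`. -/
structure IsSTorsionPair (𝒩 : NegativeFirstExtension.{w₁, w₂} 𝒟) (T F : ObjectProperty D) :
    Prop where
  isoClosed_left : T.IsClosedUnderIsomorphisms
  isoClosed_right : F.IsClosedUnderIsomorphisms
  hom_eq_zero : ∀ {X Y : D}, T X → F Y → ∀ f : X ⟶ Y, f = 0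
  exists_conflation : ∀ M : D, ∃ (X Y : D) (x : X ⟶ M) (y : M ⟶ Y),
    T X ∧ F Y ∧ 𝒟.IsConflation x y
  neg_eq_zero : ∀ {X Y : D}, T X → F Y → ∀ ε : Val 𝒩.E X Y, ε = 0

/-- `S` is a cogenerating class: every object `X` admits a conflation `X ⟶ S₀ ⟶ Y` with
`S₀ ∈ S`. -/
def IsCogenerating (S : ObjectProperty D) : Prop :=
  ∀ X : D, ∃ (S₀ Y : D) (x : X ⟶ S₀) (y : S₀ ⟶ Y), S S₀ ∧ 𝒟.IsConflation x y

/-- The class `Gen(V)`: `X` is zero, or there is a conflation `A ⟶ ∐_α V ⟶ X` with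
non-zero second morphism, for some set `α` such that `∐_α V` exists. -/
def Gen (V : D) : ObjectProperty D := fun X =>
  IsZero X ∨ ∃ (α : Type w) (_ : HasCoproduct fun _ : α => V) (A : D)
    (i : A ⟶ ∐ fun _ : α => V) (f : (∐ fun _ : α => V) ⟶ X), 𝒟.IsConflation i f ∧ f ≠ 0

/-- The class `Pres(V)`: as `Gen(V)`, with the first term of the conflation in `Gen(V)`. -/
def Pres (V : D) : ObjectProperty D := fun X =>
  IsZero X ∨ ∃ (α : Type w) (_ : HasCoproduct fun _ : α => V) (A : D)
    (i : A ⟶ ∐ fun _ : α => V) (f : (∐ fun _ : α => V) ⟶ X),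
      𝒟.IsConflation i f ∧ f ≠ 0 ∧ Gen.{w₁, w} 𝒟 V A

/-- `V^{⊥₀}`, the class of all `X` with `D(V, X) = 0`. -/
def perpZero (V : D) : ObjectProperty D := fun X => ∀ f : V ⟶ X, f = 0

/-- `V^{⊥₁}`, the class of all `X` with `𝔼(V, X) = 0`. -/
def perpOne (V : D) : ObjectProperty D := fun X => ∀ δ : Val 𝒟.E V X, δ = 0

/-- Extended tilting objects: `(Gen(V), V^{⊥₀})` is an `s`-torsion pair,
`Gen(V) = Pres(V) = V^{⊥₁}`, and `Gen(V)` is a cogenerating class. -/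
structure IsExtendedTilting (𝒩 : NegativeFirstExtension.{w₁, w₂} 𝒟) (V : D) : Prop where
  torsion : IsSTorsionPair 𝒟 𝒩 (Gen.{w₁, w} 𝒟 V) (perpZero V)
  gen_eq_pres : Gen.{w₁, w} 𝒟 V = Pres.{w₁, w} 𝒟 V
  gen_eq_perp : Gen.{w₁, w} 𝒟 V = perpOne 𝒟 V
  cogenerating : IsCogenerating 𝒟 (Gen.{w₁, w} 𝒟 V)

/-- `V` is `𝔼`-universal: every `M` admits an `𝔼`-triangle `M ⟶ A ⟶ ∐_α V` with extension `δ`,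
for some non-empty set `α`, such that `Hom(V, ∐_α V) ⟶ 𝔼(V, M)`, `φ ↦ 𝔼(φ, M)(δ)`, is
surjective. -/
def IsEUniversal (V : D) : Prop :=
  ∀ M : D, ∃ (α : Type w) (_ : Nonempty α) (_ : HasCoproduct fun _ : α => V) (A : D)
    (x : M ⟶ A) (y : A ⟶ ∐ fun _ : α => V) (δ : Val 𝒟.E (∐ fun _ : α => V) M),
    𝒟.Realizes x y δ ∧
    Function.Surjective
      (fun φ : V ⟶ ∐ fun _ : α => V => (pull 𝒟.E φ M δ : Val 𝒟.E V M))

end Notions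

end ExtendedTilting

namespace ExtendedTilting

section LongExactSequences

variable {D : Type u} [Category.{v} D]

/-! Embed `M` in a conflation `M ⟶ T ⟶ Y` with class `δ` and `T` in `Gen(V)`. Since `𝔼(V, T) = 0`,
every class in `𝔼(V, M)` is a pullback of `δ` along some `V ⟶ Y`. Such a map factors through the
torsion part `X` of `Y`, as `V` has no non-zero maps to the torsion-free part. A presentation `A ⟶ ∐
V ⟶ X` with `A` in `Gen(V)` then lifts it to `∐ V`, because `𝔼(V, A) = 0`. Hence the pullback of `δ`
along `∐ V ⟶ X ⟶ Y` is universal. Three pieces of the long exact sequences, derived from the axioms,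
carry this. -/

lemma push_id (F : Dᵒᵖ ⥤ D ⥤ AddCommGrpCat.{w}) {C A : D} (ε : Val F C A) :
    push F C (𝟙 A) ε = ε := by
  simp [push]

lemma pull_id (F : Dᵒᵖ ⥤ D ⥤ AddCommGrpCat.{w}) {C A : D} (ε : Val F C A) :
    pull F (𝟙 C) A ε = ε := by
  simp [pull]

lemma pull_comp (F : Dᵒᵖ ⥤ D ⥤ AddCommGrpCat.{w}) {C'' C' C A : D} (c' : C'' ⟶ C')
    (c : C' ⟶ C) (ε : Val F C A) :
    pull F (c' ≫ c) A ε = pull F c' A (pull F c A ε) := by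
  simp [pull]

variable [Preadditive D] [HasZeroObject D] [HasBinaryBiproducts D] (𝒟 : Extriangulated.{w₁} D)

lemma Extriangulated.exists_realizes {C A : D} (δ : Val 𝒟.E C A) :
    ∃ (B : D) (x : A ⟶ B) (y : B ⟶ C), 𝒟.Realizes x y δ := by
  obtain ⟨⟨B, x, y⟩, h⟩ := Quotient.exists_rep (𝒟.s δ)
  exact ⟨B, x, y, h.symm⟩

variable {𝒟} {A B C : D} {x : A ⟶ B} {y : B ⟶ C} {δ : Val 𝒟.E C A}

/-- Exactness of `𝔼(W, A) ⟶ 𝔼(W, B)` at `𝔼(W, A)`: every class killed by `x` is a pullback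
of `δ`. -/
lemma Extriangulated.Realizes.exists_pull_eq (h : 𝒟.Realizes x y δ) {W : D} (ε : Val 𝒟.E W A)
    (hε : push 𝒟.E W x ε = 0) : ∃ c : W ⟶ C, pull 𝒟.E c A δ = ε := by
  obtain ⟨B', x', y', h'⟩ := 𝒟.exists_realizes ε
  -- The pushout of `ε` along `x` splits, so its projection to `B` extends `x` along `x'`; (ET3)
  -- completes this to a morphism of triangles that is the identity on `A`.
  obtain ⟨b, hb, -⟩ := 𝒟.realization h' (𝒟.s_zero B W) x (𝟙 W) (by rw [hε, map_zero])
  obtain ⟨c, -, hc⟩ := 𝒟.ET3 h' h (𝟙 A) (b ≫ biprod.fst) (by rw [reassoc_of% hb]; simp)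
  exact ⟨c, by rw [← hc, push_id]⟩

/-- Exactness of `D(W, B) ⟶ D(W, C) ⟶ 𝔼(W, A)` at `D(W, C)`. -/
lemma Extriangulated.Realizes.exists_comp_deflation_eq (h : 𝒟.Realizes x y δ) {W : D}
    (c : W ⟶ C) (hc : pull 𝒟.E c A δ = 0) : ∃ b : W ⟶ B, b ≫ y = c := by
  obtain ⟨b, -, hb⟩ := 𝒟.realization (𝒟.s_zero A W) h (𝟙 A) c (by rw [hc, map_zero])
  exact ⟨biprod.inr ≫ b, by rw [Category.assoc, ← hb]; simp⟩

open ZeroObject in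
/-- Exactness of `D(W, A) ⟶ D(W, B) ⟶ D(W, C)` at `D(W, B)`. -/
lemma Extriangulated.Realizes.exists_comp_inflation_eq (h : 𝒟.Realizes x y δ) {W : D}
    (b : W ⟶ B) (hb : b ≫ y = 0) : ∃ a : W ⟶ A, a ≫ x = b := by
  -- The condition `b ≫ y = 0` makes `b` the middle of a morphism from the split triangle `W ⟶ W ⊞ 0
  -- ⟶ 0`.
  obtain ⟨a, ha, -⟩ := 𝒟.ET3op (𝒟.s_zero W (0 : D)) h (biprod.fst ≫ b) 0 (by simp [hb])
  exact ⟨a, by rw [← ha]; simp⟩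

end LongExactSequences

end ExtendedTilting

open ExtendedTilting in
theorem proposition5p8 {D : Type u} [Category.{v} D] [Preadditive D] [HasZeroObject D]
    [HasBinaryBiproducts D]
    (𝒟 : ExtendedTilting.Extriangulated.{w₁} D)
    (𝒩 : ExtendedTilting.NegativeFirstExtension.{w₁, w₂} 𝒟) (V : D)
    (hV : ExtendedTilting.IsExtendedTilting.{w₁, w₂, w} 𝒟 𝒩 V) :
    ExtendedTilting.IsEUniversal.{w₁, w} 𝒟 V := by
  intro M
  have hperp : ∀ {X : D}, Gen.{w₁, w} 𝒟 V X → ∀ ε : Val 𝒟.E V X, ε = 0 := by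
    intro X hX
    rw [hV.gen_eq_perp] at hX
    exact hX
  obtain ⟨T, Y, x, y, hT, δ, hδ⟩ := hV.cogenerating M
  obtain ⟨X, F, i, p, hX, hF, η, hη⟩ := hV.torsion.exists_conflation Y
  -- every class in `𝔼(V, M)` is pulled back from `δ` along a map factoring through `X`
  have hsurj : ∀ ε : Val 𝒟.E V M, ∃ c : V ⟶ X, pull 𝒟.E (c ≫ i) M δ = ε := by
    intro ε
    obtain ⟨c, hc⟩ := hδ.exists_pull_eq ε (hperp hT _)
    obtain ⟨a, rfl⟩ := hη.exists_comp_inflation_eq c (hF _)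
    exact ⟨a, hc⟩
  have hP := hX
  rw [hV.gen_eq_pres] at hP
  rcases hP with hzero | ⟨α, hα, A, j, f, ⟨θ, hθ⟩, hf, hA⟩
  -- For `X = 0`, `hsurj` forces `𝔼(V, M) = 0`, so the zero extension suffices; a one-point index
  -- set keeps `α` non-empty.
  · obtain ⟨B, x', y', h'⟩ := 𝒟.exists_realizes (0 : Val 𝒟.E (∐ fun _ : PUnit.{w + 1} => V) M)
    refine ⟨PUnit, inferInstance, inferInstance, B, x', y', 0, h', fun ε => ⟨0, ?_⟩⟩
    obtain ⟨c, rfl⟩ := hsurj ε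
    have hadd := 𝒟.additive.left
    have hc0 : c ≫ i = 0 := by rw [hzero.eq_of_tgt c 0, zero_comp]
    simp [hc0, pull]
  -- An empty coproduct is initial, which would force `f = 0`.
  · have hne : Nonempty α := by
      by_contra hemp
      rw [not_nonempty_iff] at hemp
      exact hf (Sigma.hom_ext _ _ fun a => hemp.elim a)
    obtain ⟨B, x', y', h'⟩ := 𝒟.exists_realizes (pull 𝒟.E (f ≫ i) M δ)
    refine ⟨α, hne, hα, B, x', y', _, h', fun ε => ?_⟩
    obtain ⟨c, rfl⟩ := hsurj ε
    -- The obstruction to lifting `c` through `f` lies in `𝔼(V, A) = 0`.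
    obtain ⟨φ, rfl⟩ := hθ.exists_comp_deflation_eq c (hperp hA _)
    exact ⟨φ, by simp only [← pull_comp, Category.assoc]⟩
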